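/- **Text and arrays.** Let $T$ be a text of length $n\ge 1$ over a linearly ordered alphabet whose last character is a sentinel smaller than every other character of $T$. Positions and array indices are numbered $0,\dots,n-1$, and $T[i..]$ is the suffix starting at $i$. The suffix array $\mathsf{SA}$ lists the starting positions of the suffixes in lexicographic order. $\mathsf{LCP}[0]=0$, and $\mathsf{LCP}[k]$ for $k\ge1$ is the length of the longest common prefix of $T[\mathsf{SA}[k]..]$ and $T[\mathsf{SA}[k-1]..]$. The permuted LCP array is given by $\mathsf{PLCP}[\mathsf{SA}[k]]=\mathsf{LCP}[k]$. $\mathsf{BWT}[k]=T[\mathsf{SA}[k]-1]$ if $\mathsf{SA}[k]\neq0$, and $\mathsf{BWT}[k]=T[n-1]$ otherwise. Let $r$ be the number of runs (maximal blocks of equal characters) of $\mathsf{BWT}$. **Peaks.** Let $\theta\ge2$ be an integer (the minimum length of a referencing factor), $P$ an array of nonnegative integers indexed by positions, $F$ a set of referencing factors (a factor $(d,\ell)$ covers the positions $d,\dots,d+\ell-1$), and $S$ a set of positions. A position $d$ is a *peak* if $P[d]\ge\theta$ and ($d=0$, or $P[d-1]<P[d]$, or a factor in $F$ ends at $d-1$).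 A peak $d$ is *interesting* with respect to $S$ if there is no $j\in S$ with $j<d<j+P[j]$ and $P[j]\ge P[d]$. An interesting peak $d$ is *maximal* with respect to $S$ if no $j\in S$ with $d<j<d+P[d]$ is an interesting peak with respect to $S$. **Algorithm.** Start with $P=\mathsf{PLCP}$, $F=\emptyset$, an empty list $L$, $s=0$ and $d=0$, and repeat the following while $d<n$, where peaks are considered with respect to $S=\{s,\dots,n-1\}$: 1. If $d$ is not an interesting peak, increment $d$. If $d$ is an interesting peak that is not maximal, insert $d$ into $L$ and increment $d$. 2. If $d$ is a maximal peak, then (a) add the factor $(d,P[d])$ to $F$; replace $P[j]$ by $\min(P[j],d-j)$ for every $j\in L\cap[d-P[d],d)$; remove from $L$ all elements that are no longer interesting peaks with respect to $L$; (b) while $L$ contains maximal peaks with respect to $L$, let $j$ be the rightmost one and $\ell=P[j]$; add the factor $(j,\ell)$ to $F$; replace $P[i]$ by $\min(P[i],j-i)$ for every $i\in L\cap[j-\ell,j)$ and by $0$ for every $i\in L\cap[j,j+\ell)$; remove from $L$ all elements that are no longer interesting peaks with respect to $L$; (c) set both $s$ and $d$ to $d+P[d]$. **Lemma.** There is an absolute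 constant $C>0$ such that, for every such text $T$ and every integer $\theta\ge2$, at any time during the run of the algorithm, $$|L|\le C\cdot\min\left(\sqrt{n\log_2 n},\; r\right).$$ That is, $|L|=O(\min(\sqrt{n\lg n},r))$. -/

import Mathlib

universe u

namespace Plcpcomp

/-! Text positions and array indices are numbered from `0`; a text of length `n` has the
positions `0, …, n - 1`. -/

/-! ### Text data structures -/

section Text

variable {α : Type u} [LinearOrder α]

/-- The text ends with a sentinel that is smaller than every other character of the text. -/
def EndsWithSentinel (T : List α) : Prop :=
  ∃ (W : List α) (e : α), T = W ++ [e] ∧ ∀ a ∈ W, e < a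

/-- Length of the longest common prefix of two strings. -/
def lcp : List α → List α → ℕ
  | a :: u, b :: v => if a = b then lcp u v + 1 else 0
  | _, _ => 0

/-- The suffix of `T` starting at position `i`. -/
def suffix (T : List α) (i : ℕ) : List α := T.drop i

/-- The suffix array: the permutation that lists the starting positions of the suffixes of `T`
in lexicographic order of the suffixes. -/
def SA (T : List α) : Equiv.Perm (Fin T.length) :=
  Tuple.sort (fun i : Fin T.length => suffix T i)

/-- The inverse suffix array. -/
def ISA (T : List α) : Equiv.Perm (Fin T.length) := (SA T).symm

/-- The LCP array. Its first entry is `0`; every other entry is the length of the longest common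
prefix of a suffix and its lexicographic predecessor. -/
def LCP (T : List α) (k : Fin T.length) : ℕ :=
  if k.val = 0 then 0
  else lcp (suffix T (SA T k)) (suffix T (SA T ⟨k.val - 1, (Nat.sub_le _ _).trans_lt k.isLt⟩))

/-- The permuted LCP array: the LCP array in text order (and `0` outside of the text). -/
def PLCP (T : List α) (i : ℕ) : ℕ :=
  if h : i < T.length then LCP T (ISA T ⟨i, h⟩) else 0

/-- The Burrows-Wheeler transform: the character that precedes the `k`-th smallest suffix, and
the last character of `T` for the suffix that is the whole text. -/
def BWT (T : List α) (k : Fin T.length) : α :=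
  if (SA T k).val = 0 then T[T.length - 1]'(Nat.sub_lt (Nat.zero_lt_of_lt k.isLt) Nat.one_pos)
  else T[(SA T k).val - 1]'((Nat.sub_le _ _).trans_lt (SA T k).isLt)

/-- The number of runs (maximal blocks of equal characters) of the BWT, counted through the
indices at which a run begins. -/
def bwtRuns (T : List α) : ℕ :=
  (Finset.univ.filter (fun k : Fin T.length =>
    k.val = 0 ∨ BWT T k ≠ BWT T ⟨k.val - 1, (Nat.sub_le _ _).trans_lt k.isLt⟩)).card

end Text

/-! ### Peaks

`θ` is the minimum length of a referencing factor, `P` is the current (rewritable) PLCP array, `F`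
is the set of referencing factors created so far, where `(d, ℓ)` is the factor that covers the
positions `d, …, d + ℓ - 1`, and `S` is the set of text positions that are taken into account. -/

/-- `d` is a peak. -/
def IsPeak (θ : ℕ) (P : ℕ → ℕ) (F : Finset (ℕ × ℕ)) (d : ℕ) : Prop :=
  θ ≤ P d ∧ (d = 0 ∨ P (d - 1) < P d ∨ ∃ f ∈ F, f.1 + f.2 = d)

/-- `d` is an interesting peak. -/
def IsInteresting (θ : ℕ) (P : ℕ → ℕ) (F : Finset (ℕ × ℕ)) (S : Finset ℕ) (d : ℕ) : Prop :=
  IsPeak θ P F d ∧ ¬ ∃ j ∈ S, (j < d ∧ d < j + P j) ∧ P d ≤ P j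

/-- `d` is a maximal peak. -/
def IsMaximal (θ : ℕ) (P : ℕ → ℕ) (F : Finset (ℕ × ℕ)) (S : Finset ℕ) (d : ℕ) : Prop :=
  IsInteresting θ P F S d ∧
    ¬ ∃ j ∈ S, (d < j ∧ j < d + P d) ∧ IsInteresting θ P F S j

/-! ### The compression algorithm -/

/-- Rule (D) for a factor `(d, ℓ)`, applied to the positions in `L`:
`P[j] ← min (P[j], d - j)` for `j ∈ [d - ℓ, d)`. -/
def ruleD (L : Finset ℕ) (d l : ℕ) (P : ℕ → ℕ) : ℕ → ℕ := fun j =>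
  if j ∈ L ∧ d ≤ j + l ∧ j < d then min (P j) (d - j) else P j

/-- Rule (R) for a factor `(d, ℓ)`, applied to the positions in `L`:
`P[j] ← 0` for `j ∈ [d, d + ℓ)`. -/
def ruleR (L : Finset ℕ) (d l : ℕ) (P : ℕ → ℕ) : ℕ → ℕ := fun j =>
  if j ∈ L ∧ d ≤ j ∧ j < d + l then 0 else P j

open Classical in
/-- The elements of `L` that are (still) interesting peaks, among the positions in `L`. -/
noncomputable def keepInteresting (θ : ℕ) (P : ℕ → ℕ) (F : Finset (ℕ × ℕ)) (L : Finset ℕ) :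
    Finset ℕ :=
  L.filter (fun d => IsInteresting θ P F L d)

/-- The algorithm either scans the text for a maximal peak, or, after it has found one, processes
the list `L`. -/
inductive Phase
  | scan
  | process

/-- A state of the algorithm: the phase, the scan position `pos`, the beginning `start` of the
part of the text that follows the last factor found by the scan (all of this part is still to be
factorized), the current PLCP values `P`, the referencing factors `F` created so far, and the list
`L` of interesting peaks. -/
structure State where
  phase : Phase
  pos : ℕ
  start : ℕ
  P : ℕ → ℕ
  F : Finset (ℕ × ℕ)
  L : Finset ℕ

/-- The initial state. -/
def init {α : Type u} [LinearOrder α] (T : List α) : State where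
  phase := Phase.scan
  pos := 0
  start := 0
  P := PLCP T
  F := ∅
  L := ∅

/-- The positions of the part of the text that the scan is working on, which is treated as a text
of its own. -/
def State.rest (n : ℕ) (s : State) : Finset ℕ := Finset.Ico s.start n

/-- One step of the algorithm on a text of length `n`. -/
inductive Step (n θ : ℕ) : State → State → Prop
  /-- The scan passes a position that is not an interesting peak. -/
  | skip (s : State) (hs : s.phase = Phase.scan) (hn : s.pos < n)
      (h : ¬ IsInteresting θ s.P s.F (s.rest n) s.pos) :
      Step n θ s { s with pos := s.pos + 1 }
  /-- The scan passes an interesting peak that is not maximal and inserts it into `L`. -/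
  | insert (s : State) (hs : s.phase = Phase.scan) (hn : s.pos < n)
      (h : IsInteresting θ s.P s.F (s.rest n) s.pos)
      (hm : ¬ IsMaximal θ s.P s.F (s.rest n) s.pos) :
      Step n θ s { s with pos := s.pos + 1, L := Insert.insert s.pos s.L }
  /-- The scan finds a maximal peak: a referencing factor is created there, Rule (D) is applied to
  `L`, and the elements that are no longer interesting peaks are removed from `L`. -/
  | factor (s : State) (hs : s.phase = Phase.scan) (hn : s.pos < n)
      (hm : IsMaximal θ s.P s.F (s.rest n) s.pos)
      (P' : ℕ → ℕ) (hP : P' = ruleD s.L s.pos (s.P s.pos) s.P)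
      (F' : Finset (ℕ × ℕ)) (hF : F' = Insert.insert (s.pos, s.P s.pos) s.F) :
      Step n θ s { s with
        phase := Phase.process, P := P', F := F', L := keepInteresting θ P' F' s.L }
  /-- While `L` contains maximal peaks, a referencing factor is created at the rightmost one, `j`;
  Rules (D) and (R) are applied to `L`, and the elements that are no longer interesting peaks are
  removed from `L`. -/
  | loop (s : State) (hs : s.phase = Phase.process) (j : ℕ) (hj : j ∈ s.L)
      (hm : IsMaximal θ s.P s.F s.L j)
      (hright : ∀ k ∈ s.L, IsMaximal θ s.P s.F s.L k → k ≤ j)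
      (P' : ℕ → ℕ) (hP : P' = ruleR s.L j (s.P j) (ruleD s.L j (s.P j) s.P))
      (F' : Finset (ℕ × ℕ)) (hF : F' = Insert.insert (j, s.P j) s.F) :
      Step n θ s { s with P := P', F := F', L := keepInteresting θ P' F' s.L }
  /-- When `L` contains no maximal peak any more, the scan is resumed behind the factor that it
  has found last. -/
  | resume (s : State) (hs : s.phase = Phase.process)
      (hm : ∀ k ∈ s.L, ¬ IsMaximal θ s.P s.F s.L k) :
      Step n θ s { s with
        phase := Phase.scan, pos := s.pos + s.P s.pos, start := s.pos + s.P s.pos }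

/-- The states that occur when the algorithm is run on the text `T` with threshold `θ`. -/
def Reachable {α : Type u} [LinearOrder α] (T : List α) (θ : ℕ) (s : State) : Prop :=
  Relation.ReflTransGen (Step T.length θ) (init T) s

end Plcpcomp

/-!
While the scan has not found a maximal peak, every interesting peak it passes has another one inside
its factor, and being interesting forces the value there to be larger. Hence PLCP is positive and
strictly increasing along `L`, and every element of `L` but the first is an ascent of PLCP. An
ascent is an irreducible value: if a suffix and its lexicographic predecessor were preceded by the
same character, then PLCP would drop by at most one from the position before.

Irreducible values belong to the run boundaries of the BWT, up to two exceptions, which gives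
`|L| = O(r)`. Moreover, their sum is at most `2 n log₂ n`. An irreducible value `ℓ` at `i` yields,
for each `h < ℓ`, two positions `i + h` and `Φ[i] + h` whose left contexts of length `h` agree while
those of length `h + 1` differ, so for one of the two positions the class of positions with the same
left context shrinks to at most half; at a fixed position this happens at most `log₂ n` times. As
`k` distinct positive integers sum to at least `k² / 2`, also `|L| = O(√(n log₂ n))`.
-/

namespace Plcpcomp

open Finset

section Counting

theorem card_sq_le_two_mul_sum {ι : Type*} {s : Finset ι} {f : ι → ℕ} (hf : Set.InjOn f s)
    (hpos : ∀ x ∈ s, 0 < f x) : #s ^ 2 ≤ 2 * ∑ x ∈ s, f x := by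
  have hf' : Set.InjOn (fun x => (f x : ℤ)) s := Nat.cast_injective.comp_injOn hf
  have hsum : ∑ i ∈ range #s, (1 + i) ≤ ∑ x ∈ s, f x := by
    have h := sum_range_le_sum (s := s.image fun x => (f x : ℤ)) (c := 1)
      (by simpa [Nat.one_le_iff_ne_zero, Nat.pos_iff_ne_zero] using hpos)
    rw [card_image_of_injOn hf', sum_image hf'] at h
    exact_mod_cast h
  have hgauss : (∑ i ∈ range #s, (1 + i)) * 2 = (#s + 1) * #s := by
    simpa [sum_range_succ', add_comm 1] using sum_range_id_mul_two (#s + 1)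
  nlinarith

theorem card_le_two_mul_of_forall_mem_or {β γ : Type*} {s : Finset β} {t : Finset γ}
    {f g : β → γ} (hf : Set.InjOn f s) (hg : Set.InjOn g s)
    (h : ∀ x ∈ s, f x ∈ t ∨ g x ∈ t) : #s ≤ 2 * #t := by
  classical
  have hleft : #{x ∈ s | f x ∈ t} ≤ #t :=
    card_le_card_of_injOn f (fun x hx => (mem_filter.1 hx).2) (hf.mono (filter_subset _ _))
  have hright : #{x ∈ s | f x ∉ t} ≤ #t :=
    card_le_card_of_injOn g
      (fun x hx => (h x (mem_filter.1 hx).1).resolve_left (mem_filter.1 hx).2)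
      (hg.mono (filter_subset _ _))
  have := card_filter_add_card_filter_not (s := s) (fun x => f x ∈ t)
  omega

theorem two_pow_card_halving_mul_le {c : ℕ → ℕ} (hc : Antitone c) (m : ℕ) :
    2 ^ #{h ∈ range m | 2 * c (h + 1) ≤ c h} * c m ≤ c 0 := by
  induction m with
  | zero => simp
  | succ m ih =>
    rw [range_add_one, filter_insert]
    refine le_trans ?_ ih
    split_ifs with h
    · rw [card_insert_of_notMem (by simp), pow_succ, mul_assoc]
      exact Nat.mul_le_mul_left _ h
    · exact Nat.mul_le_mul_left _ (hc (Nat.le_succ m))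

theorem card_halving_le_log {c : ℕ → ℕ} (hc : Antitone c) {m : ℕ} (hm : 0 < c m) :
    #{h ∈ range m | 2 * c (h + 1) ≤ c h} ≤ Nat.log 2 (c 0) :=
  Nat.le_log_of_pow_le one_lt_two <|
    (Nat.le_mul_of_pos_right _ hm).trans (two_pow_card_halving_mul_le hc m)

end Counting

section Refinement

variable {ι : Type*} {s : Finset ι}

open Classical in
/-- The equivalence class of `p` within the finite set `s`. -/
noncomputable def classIn (s : Finset ι) (r : Setoid ι) (p : ι) : Finset ι := {q ∈ s | r p q}

theorem mem_classIn {r : Setoid ι} {p q : ι} : q ∈ classIn s r p ↔ q ∈ s ∧ r p q := by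
  simp [classIn]

theorem classIn_mono (s : Finset ι) (p : ι) : Monotone fun r => classIn s r p :=
  fun _ _ hr _ hq => mem_classIn.2 ⟨(mem_classIn.1 hq).1, hr (mem_classIn.1 hq).2⟩

theorem classIn_congr {r : Setoid ι} {p q : ι} (h : r p q) : classIn s r p = classIn s r q := by
  ext x
  simp only [mem_classIn]
  exact and_congr_right fun _ => ⟨r.trans (r.symm h), r.trans h⟩

theorem disjoint_classIn {r : Setoid ι} {p q : ι} (h : ¬ r p q) :
    Disjoint (classIn s r p) (classIn s r q) :=
  disjoint_left.2 fun _ hp hq => h (r.trans (mem_classIn.1 hp).2 (r.symm (mem_classIn.1 hq).2))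

/-- The pairs `(p, h)` with `p ∈ s` and `h < m` such that the class of `p` in `s` shrinks to at most
half of its size when the equivalence relation `r h` is replaced by `r (h + 1)`. -/
noncomputable def halvingPairs (s : Finset ι) (r : ℕ → Setoid ι) (m : ℕ) : Finset (ι × ℕ) :=
  {x ∈ s ×ˢ range m | 2 * #(classIn s (r (x.2 + 1)) x.1) ≤ #(classIn s (r x.2) x.1)}

theorem card_halvingPairs_le {r : ℕ → Setoid ι} (hr : Antitone r) (m : ℕ) :
    #(halvingPairs s r m) ≤ #s * Nat.log 2 #s := by
  rw [halvingPairs, card_filter, sum_product]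
  simp only [← card_filter]
  refine sum_le_card_nsmul _ _ _ fun p hp => ?_
  have hanti : Antitone fun h => #(classIn s (r h) p) := fun _ _ hh =>
    card_le_card (classIn_mono s p (hr hh))
  refine (card_halving_le_log hanti ?_).trans (Nat.log_mono_right (card_le_card ?_))
  · exact card_pos.2 ⟨p, mem_classIn.2 ⟨hp, (r m).refl p⟩⟩
  · exact fun q hq => (mem_classIn.1 hq).1

-- Two disjoint subclasses of the same class cannot both have more than half of its elements.
theorem mem_halvingPairs_or {r : ℕ → Setoid ι} (hr : Antitone r) {p q : ι} {h m : ℕ} (hp : p ∈ s)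
    (hq : q ∈ s) (hm : h < m) (hrel : r h p q) (hsep : ¬ r (h + 1) p q) :
    (p, h) ∈ halvingPairs s r m ∨ (q, h) ∈ halvingPairs s r m := by
  classical
  have hsub : classIn s (r (h + 1)) p ∪ classIn s (r (h + 1)) q ⊆ classIn s (r h) p :=
    union_subset (classIn_mono s p (hr h.le_succ))
      (classIn_congr (s := s) hrel ▸ classIn_mono s q (hr h.le_succ))
  have hcard := card_le_card hsub
  rw [card_union_of_disjoint (disjoint_classIn hsep)] at hcard
  simp only [halvingPairs, mem_filter, mem_product, mem_range, hp, hq, hm, true_and,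
    ← classIn_congr hrel]
  omega

end Refinement


section Strings

variable {α : Type u} [LinearOrder α]

theorem lcp_le_length_left (u v : List α) : lcp u v ≤ u.length := by
  fun_induction lcp u v <;> simp_all

theorem lcp_le_length_right (u v : List α) : lcp u v ≤ v.length := by
  fun_induction lcp u v <;> simp_all

theorem take_eq_take_of_le_lcp {u v : List α} {h : ℕ} (hh : h ≤ lcp u v) :
    u.take h = v.take h := by
  induction u generalizing v h with
  | nil => simp_all [lcp]
  | cons a u ih =>
    cases v with
    | nil => simp_all [lcp]
    | cons b v =>
      by_cases hab : a = b
      · rcases h with - | h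
        · simp
        · simp only [lcp, hab, if_true, Nat.add_le_add_iff_right] at hh
          simp [hab, ih hh]
      · simp_all [lcp]

theorem cons_le_cons_iff {a b : α} {u v : List α} :
    a :: u ≤ b :: v ↔ a < b ∨ a = b ∧ u ≤ v := by
  simpa only [← List.not_lt, _root_.not_lt] using List.cons_le_cons_iff (a := a) (l₁ := u)

theorem lcp_le_lcp_of_le_of_le {u v w : List α} (huv : u ≤ v) (hvw : v ≤ w) :
    lcp w u ≤ lcp w v := by
  induction w generalizing u v with
  | nil => simp [lcp]
  | cons a w ih =>
    rcases u with - | ⟨b, u⟩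
    · simp [lcp]
    by_cases hab : a = b
    · subst hab
      rcases v with - | ⟨c, v⟩
      · exact absurd huv (by simp)
      rw [cons_le_cons_iff] at huv hvw
      obtain rfl : a = c := le_antisymm
        (huv.elim le_of_lt fun h => h.1.le) (hvw.elim le_of_lt fun h => h.1.le)
      simp only [lt_irrefl, false_or, true_and] at huv hvw
      simpa [lcp] using ih huv hvw
    · simp [lcp, hab]

end Strings

section SuffixArray

variable {α : Type u}

theorem suffix_eq_cons {T : List α} {i : ℕ} (hi : i < T.length) :
    suffix T i = T[i] :: suffix T (i + 1) := by
  simp [suffix]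

theorem suffix_injOn (T : List α) : Set.InjOn (suffix T) (Set.Iio T.length) := by
  intro i hi j hj h
  have hlen := congrArg List.length h
  simp only [suffix, List.length_drop] at hlen
  simp only [Set.mem_Iio] at hi hj
  omega

variable [LinearOrder α] {T : List α}

theorem strictMono_suffix_SA (T : List α) : StrictMono fun k => suffix T (SA T k) :=
  (Tuple.monotone_sort fun i : Fin T.length => suffix T i).strictMono_of_injective
    fun k l h => (SA T).injective
      (Fin.ext (suffix_injOn T (SA T k).isLt (SA T l).isLt h))

theorem suffix_lt_suffix_iff {i j : Fin T.length} :
    suffix T i < suffix T j ↔ ISA T i < ISA T j := by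
  rw [← (strictMono_suffix_SA T).lt_iff_lt]
  simp [ISA]

/-- The index that precedes `k` in an array; the first index is its own predecessor. -/
def prevIndex {n : ℕ} (k : Fin n) : Fin n := ⟨k.val - 1, (Nat.sub_le _ _).trans_lt k.isLt⟩

theorem prevIndex_eq_self {n : ℕ} {k : Fin n} : prevIndex k = k ↔ k.val = 0 := by
  simp only [prevIndex, Fin.ext_iff]
  omega

theorem prevIndex_injOn (n : ℕ) : Set.InjOn (prevIndex (n := n)) {k | prevIndex k ≠ k} := by
  intro k hk l hl h
  simp only [Set.mem_ofPred_eq, ne_eq, prevIndex_eq_self] at hk hl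
  simp only [prevIndex, Fin.ext_iff] at h ⊢
  omega

theorem le_prevIndex_of_lt {n : ℕ} {k l : Fin n} (h : k < l) : k ≤ prevIndex l := by
  simp only [prevIndex, Fin.lt_def, Fin.le_def] at h ⊢
  omega

/-- The starting position of the lexicographic predecessor of the suffix that starts at `i`
(the array `Φ` of the literature). The position of the smallest suffix is mapped to itself. -/
def lexPred (T : List α) (i : Fin T.length) : Fin T.length := SA T (prevIndex (ISA T i))

theorem ISA_lexPred (i : Fin T.length) : ISA T (lexPred T i) = prevIndex (ISA T i) := by
  simp [lexPred, ISA]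

theorem lexPred_eq_self {i : Fin T.length} : lexPred T i = i ↔ (ISA T i).val = 0 := by
  rw [← (ISA T).apply_eq_iff_eq, ISA_lexPred, prevIndex_eq_self]

theorem lexPred_injOn (T : List α) : Set.InjOn (lexPred T) {i | lexPred T i ≠ i} := by
  intro i hi j hj h
  simp only [Set.mem_ofPred_eq, ne_eq, lexPred_eq_self, ← prevIndex_eq_self] at hi hj
  exact (ISA T).injective (prevIndex_injOn _ hi hj ((SA T).injective h))

theorem suffix_lexPred_lt {i : Fin T.length} (hi : lexPred T i ≠ i) :
    suffix T (lexPred T i) < suffix T i := by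
  rw [suffix_lt_suffix_iff, ISA_lexPred]
  rw [ne_eq, lexPred_eq_self] at hi
  simp only [prevIndex, Fin.lt_def]
  omega

theorem suffix_le_suffix_lexPred {i j : Fin T.length} (h : suffix T j < suffix T i) :
    suffix T j ≤ suffix T (lexPred T i) := by
  rw [← not_lt, suffix_lt_suffix_iff, ISA_lexPred, not_lt]
  exact le_prevIndex_of_lt (suffix_lt_suffix_iff.1 h)

theorem lexPred_ne_of_suffix_lt {i j : Fin T.length} (h : suffix T j < suffix T i) :
    lexPred T i ≠ i := by
  have hlt := suffix_lt_suffix_iff.1 h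
  rw [ne_eq, lexPred_eq_self]
  rw [Fin.lt_def] at hlt
  omega

theorem PLCP_of_lexPred_eq {i : Fin T.length} (hi : lexPred T i = i) : PLCP T i = 0 := by
  simp [PLCP, LCP, lexPred_eq_self.1 hi]

theorem PLCP_of_lexPred_ne {i : Fin T.length} (hi : lexPred T i ≠ i) :
    PLCP T i = lcp (suffix T i) (suffix T (lexPred T i)) := by
  rw [ne_eq, lexPred_eq_self] at hi
  simp only [PLCP, Fin.is_lt, dif_pos, LCP, hi, if_false, lexPred, prevIndex]
  simp [ISA]

theorem lcp_suffix_le_PLCP {i j : Fin T.length} (h : suffix T j < suffix T i) :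
    lcp (suffix T i) (suffix T j) ≤ PLCP T i := by
  have hi := lexPred_ne_of_suffix_lt h
  rw [PLCP_of_lexPred_ne hi]
  exact lcp_le_lcp_of_le_of_le (suffix_le_suffix_lexPred h) (suffix_lexPred_lt hi).le

theorem lt_length_of_PLCP_pos {i : ℕ} (hi : 0 < PLCP T i) : i < T.length := by
  by_contra h
  simp [PLCP, h] at hi

theorem two_le_length_of_PLCP_pos {i : ℕ} (hi : 0 < PLCP T i) : 2 ≤ T.length := by
  let j : Fin T.length := ⟨i, lt_length_of_PLCP_pos hi⟩
  have hj : (ISA T j).val ≠ 0 := fun h0 =>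
    hi.ne' (PLCP_of_lexPred_eq (i := j) (lexPred_eq_self.2 h0))
  have := (ISA T j).isLt
  omega

end SuffixArray

section LeftContext

variable {α : Type u} {T : List α}

/-- The `h` characters in front of position `p`, read from right to left. There are fewer of them if
`p < h`; hence a context that is cut off at the beginning of the text determines its position. -/
def leftContext (T : List α) (p h : ℕ) : List α := (T.take p).reverse.take h

theorem take_leftContext {p h k : ℕ} (hk : k ≤ h) :
    (leftContext T p h).take k = leftContext T p k := by
  simp [leftContext, List.take_take, hk]

theorem leftContext_zero_left (T : List α) (h : ℕ) : leftContext T 0 h = [] := by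
  simp [leftContext]

theorem leftContext_zero_right (T : List α) (p : ℕ) : leftContext T p 0 = [] := by
  simp [leftContext]

theorem leftContext_add {i h : ℕ} (hi : i + h ≤ T.length) (k : ℕ) :
    leftContext T (i + h) (h + k) = ((suffix T i).take h).reverse ++ leftContext T i k := by
  have hlen : ((suffix T i).take h).reverse.length = h := by
    simp only [suffix, List.length_reverse, List.length_take, List.length_drop]
    omega
  calc leftContext T (i + h) (h + k)
      = (((suffix T i).take h).reverse ++ (T.take i).reverse).take (h + k) := by
        rw [leftContext, List.take_add (i := i), List.reverse_append, suffix]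
    _ = ((suffix T i).take h).reverse ++ leftContext T i k := by
        rw [List.take_append, hlen, Nat.add_sub_cancel_left, List.take_of_length_le (by omega),
          leftContext]

theorem leftContext_succ_one {p : ℕ} (hp : p < T.length) : leftContext T (p + 1) 1 = [T[p]] := by
  simp [leftContext_add (T := T) (i := p) (h := 1) hp 0, suffix_eq_cons hp, leftContext_zero_right]

/-- Positions are equivalent if they have the same left context of length `h`. -/
def contextSetoid (T : List α) (h : ℕ) : Setoid ℕ := Setoid.ker fun p => leftContext T p h

theorem contextSetoid_iff {h p q : ℕ} :
    contextSetoid T h p q ↔ leftContext T p h = leftContext T q h :=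
  Setoid.ker_def

theorem contextSetoid_antitone (T : List α) : Antitone (contextSetoid T) := by
  intro k h hk p q hpq
  rw [contextSetoid_iff] at hpq ⊢
  rw [← take_leftContext hk, hpq, take_leftContext hk]

end LeftContext

section Irreducible

variable {α : Type u} [LinearOrder α] {T : List α}

/-- The value `PLCP[i]` is irreducible if the suffix that starts at `i` and its lexicographic
predecessor are preceded by different characters, or if exactly one of them is the whole text. -/
def IsIrreducible (T : List α) (i : Fin T.length) : Prop :=
  leftContext T i 1 ≠ leftContext T (lexPred T i) 1

theorem IsIrreducible.lexPred_ne {i : Fin T.length} (hi : IsIrreducible T i) : lexPred T i ≠ i :=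
  fun h => hi (by rw [h])

-- If both suffixes are preceded by the same character, prepending it gives a smaller suffix whose
-- longest common prefix with the suffix at `d` is longer by one.
theorem isIrreducible_of_PLCP_lt {d : ℕ} (h : PLCP T d < PLCP T (d + 1)) :
    IsIrreducible T ⟨d + 1, lt_length_of_PLCP_pos (pos_of_gt h)⟩ := by
  have hd := lt_length_of_PLCP_pos (pos_of_gt h)
  set i : Fin T.length := ⟨d + 1, hd⟩
  have hi : lexPred T i ≠ i := fun heq => h.not_ge (by simp [PLCP_of_lexPred_eq heq, i])
  have hlt := suffix_lexPred_lt hi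
  have hPLCP := PLCP_of_lexPred_ne hi
  intro hctx
  have hd' : d < T.length := d.lt_succ_self.trans hd
  rcases hj : lexPred T i with ⟨_ | e, he⟩
  · simp [hj, i, leftContext_succ_one hd', leftContext_zero_left] at hctx
  have he' : e < T.length := e.lt_succ_self.trans he
  have hchar : T[d] = T[e] := by
    simpa [hj, i, leftContext_succ_one hd', leftContext_succ_one he'] using hctx
  have hlt' : suffix T e < suffix T d := by
    rw [suffix_eq_cons hd', suffix_eq_cons he', List.cons_lt_cons_iff]
    exact Or.inr ⟨hchar.symm, by simpa [hj, i] using hlt⟩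
  have hle : lcp (suffix T d) (suffix T e) ≤ PLCP T d :=
    lcp_suffix_le_PLCP (i := ⟨d, hd'⟩) (j := ⟨e, he'⟩) hlt'
  rw [suffix_eq_cons hd', suffix_eq_cons he', lcp, if_pos hchar] at hle
  simp only [hj, i] at hPLCP
  omega

theorem leftContext_SA_one {k : Fin T.length} (hk : (SA T k).val ≠ 0) :
    leftContext T (SA T k) 1 = [BWT T k] := by
  obtain ⟨p, hp⟩ := Nat.exists_eq_succ_of_ne_zero hk
  have hlt := (SA T k).isLt
  simp only [BWT, hp, Nat.succ_eq_add_one] at hlt ⊢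
  simp [leftContext_succ_one (T := T) (p := p) (by omega)]

theorem bwtRuns_eq (hT : 0 < T.length) :
    bwtRuns T = #{k | BWT T k ≠ BWT T (prevIndex k)} + 1 := by
  have h0 : prevIndex ⟨0, hT⟩ = ⟨0, hT⟩ := prevIndex_eq_self.2 rfl
  rw [← card_insert_of_notMem (a := ⟨0, hT⟩) (by simp [h0]), bwtRuns]
  congr 1
  ext k
  rw [mem_insert, mem_filter, mem_filter, Fin.ext_iff]
  simp only [mem_univ, true_and, prevIndex]

theorem IsIrreducible.BWT_ne {i : Fin T.length} (hi : IsIrreducible T i) (h0 : i.val ≠ 0)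
    (hpred : (lexPred T i).val ≠ 0) :
    BWT T (ISA T i) ≠ BWT T (prevIndex (ISA T i)) := by
  intro h
  have hSA : SA T (ISA T i) = i := by simp [ISA]
  have hleft := leftContext_SA_one (k := ISA T i) (by rwa [hSA])
  rw [hSA] at hleft
  exact hi (hleft.trans ((leftContext_SA_one hpred).trans (by rw [h])).symm)

-- Besides the positions at which a run of the BWT begins there are at most two: position `0`, and
-- the position of the suffix whose lexicographic predecessor is the whole text.
open Classical in
theorem card_isIrreducible_le (T : List α) :
    #{i | IsIrreducible T i} ≤ bwtRuns T + 1 := by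
  rcases T.length.eq_zero_or_pos with hT | hT
  · have : IsEmpty (Fin T.length) := hT ▸ inferInstance
    simp
  have hsub : ({i | IsIrreducible T i} : Finset (Fin T.length)) ⊆
      ({i | i.val = 0} : Finset (Fin T.length)) ∪
        ({i | IsIrreducible T i ∧ (lexPred T i).val = 0} : Finset (Fin T.length)) ∪
        ({k | BWT T k ≠ BWT T (prevIndex k)} : Finset (Fin T.length)).image (SA T) := by
    intro i hi
    simp only [mem_filter, mem_univ, true_and, mem_union, mem_image] at hi ⊢
    by_contra! h
    exact h.2 (ISA T i) (hi.BWT_ne h.1.1 (h.1.2 hi)) (by simp [ISA])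
  have hzero : #{i : Fin T.length | i.val = 0} ≤ 1 :=
    card_le_one.2 fun i hi j hj => by simp_all [Fin.ext_iff]
  have hpred : #{i | IsIrreducible T i ∧ (lexPred T i).val = 0} ≤ 1 :=
    card_le_one.2 fun i hi j hj => by
      simp only [mem_filter, mem_univ, true_and] at hi hj
      exact lexPred_injOn T hi.1.lexPred_ne hj.1.lexPred_ne (Fin.ext (hi.2.trans hj.2.symm))
  have hcard := (card_le_card hsub).trans ((card_union_le _ _).trans
    (add_le_add (card_union_le _ _) card_image_le))
  rw [bwtRuns_eq hT]
  omega

end Irreducible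

section IrreducibleSum

variable {α : Type u} {T : List α}

theorem contextSetoid_add_iff {i j h : ℕ} (hi : i + h ≤ T.length) (hj : j + h ≤ T.length)
    (htake : (suffix T i).take h = (suffix T j).take h) (k : ℕ) :
    contextSetoid T (h + k) (i + h) (j + h) ↔ contextSetoid T k i j := by
  simp only [contextSetoid_iff, leftContext_add hi, leftContext_add hj, htake,
    List.append_cancel_left_eq]

variable [LinearOrder α]

theorem IsIrreducible.mem_halvingPairs_or {i : Fin T.length} (hi : IsIrreducible T i) {h : ℕ}
    (hh : h < PLCP T i) :
    (i.val + h, h) ∈ halvingPairs (range T.length) (contextSetoid T) T.length ∨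
      ((lexPred T i).val + h, h) ∈
        halvingPairs (range T.length) (contextSetoid T) T.length := by
  rw [PLCP_of_lexPred_ne hi.lexPred_ne] at hh
  have hlt : i + h < T.length := by
    have := hh.trans_le (lcp_le_length_left _ _)
    rw [suffix, List.length_drop] at this
    omega
  have hlt' : lexPred T i + h < T.length := by
    have := hh.trans_le (lcp_le_length_right _ _)
    rw [suffix, List.length_drop] at this
    omega
  have hiff := contextSetoid_add_iff hlt.le hlt'.le (take_eq_take_of_le_lcp hh.le)
  refine Plcpcomp.mem_halvingPairs_or (contextSetoid_antitone T) (mem_range.2 hlt)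
    (mem_range.2 hlt') (by omega) ((hiff 0).2 ?_) (mt (hiff 1).1 hi)
  simp [contextSetoid_iff, leftContext_zero_right]

open Classical in
theorem sum_PLCP_isIrreducible_le (T : List α) :
    ∑ i with IsIrreducible T i, PLCP T i ≤ 2 * (T.length * Nat.log 2 T.length) := by
  set D : Finset ((_ : Fin T.length) × ℕ) :=
    ({i | IsIrreducible T i} : Finset (Fin T.length)).sigma fun i => range (PLCP T i) with hD
  have hmem : ∀ x ∈ D, IsIrreducible T x.1 ∧ x.2 < PLCP T x.1 := fun x hx => by
    simpa [hD] using hx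
  calc ∑ i with IsIrreducible T i, PLCP T i
      = #D := by simp [hD]
    _ ≤ 2 * #(halvingPairs (range T.length) (contextSetoid T) T.length) :=
        card_le_two_mul_of_forall_mem_or (f := fun x => (x.1.val + x.2, x.2))
          (g := fun x => ((lexPred T x.1).val + x.2, x.2)) ?_ ?_
          fun x hx => (hmem x hx).1.mem_halvingPairs_or (hmem x hx).2
    _ ≤ 2 * (T.length * Nat.log 2 T.length) := by
        simpa using card_halvingPairs_le (s := range T.length) (contextSetoid_antitone T) T.length
  · rintro ⟨i, h⟩ - ⟨j, k⟩ - heq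
    simp only [Prod.mk.injEq] at heq
    obtain ⟨heq, rfl⟩ := heq
    obtain rfl : i = j := Fin.ext (Nat.add_right_cancel heq)
    rfl
  · rintro ⟨i, h⟩ hi ⟨j, k⟩ hj heq
    simp only [Prod.mk.injEq] at heq
    obtain ⟨heq, rfl⟩ := heq
    obtain rfl : i = j := lexPred_injOn T (hmem _ hi).1.lexPred_ne (hmem _ hj).1.lexPred_ne
      (Fin.ext (Nat.add_right_cancel heq))
    rfl

end IrreducibleSum

section Peaks

variable {θ : ℕ} {P : ℕ → ℕ} {F : Finset (ℕ × ℕ)} {S L : Finset ℕ} {d : ℕ}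

theorem IsInteresting.mono {S' : Finset ℕ} (hS : S' ⊆ S) (h : IsInteresting θ P F S d) :
    IsInteresting θ P F S' d :=
  ⟨h.1, fun ⟨j, hj, hj'⟩ => h.2 ⟨j, hS hj, hj'⟩⟩

theorem IsInteresting.lt_of_mem {j : ℕ} (h : IsInteresting θ P F S d) (hj : j ∈ S) (hjd : j < d)
    (hd : d < j + P j) : P j < P d :=
  not_le.1 fun hle => h.2 ⟨j, hj, ⟨hjd, hd⟩, hle⟩

theorem IsInteresting.exists_of_not_isMaximal (h : IsInteresting θ P F S d)
    (hm : ¬ IsMaximal θ P F S d) :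
    ∃ j ∈ S, d < j ∧ j < d + P d ∧ IsInteresting θ P F S j := by
  simpa [IsMaximal, h, and_assoc] using hm

theorem lt_of_forall_not_isMaximal {q : ℕ} (hd : IsInteresting θ P F S d)
    (hq : IsInteresting θ P F S q) (hdS : d ∈ S) (hdq : d < q)
    (hmax : ∀ j ∈ S, d ≤ j → j < q → ¬ IsMaximal θ P F S j) : P d < P q := by
  induction hm : q - d using Nat.strong_induction_on generalizing d with
  | _ m ih =>
    obtain ⟨k, hkS, hdk, hkd, hk⟩ := hd.exists_of_not_isMaximal (hmax d hdS le_rfl hdq)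
    rcases lt_or_ge k q with hkq | hqk
    · exact (hk.lt_of_mem hdS hdk hkd).trans
        (ih (q - k) (by omega) hk hkS hkq (fun j hj hkj => hmax j hj (by omega)) rfl)
    · exact hq.lt_of_mem hdS hdq (by omega)

theorem keepInteresting_subset : keepInteresting θ P F L ⊆ L :=
  by classical exact filter_subset _ _

theorem isInteresting_of_mem_keepInteresting (hd : d ∈ keepInteresting θ P F L) :
    IsInteresting θ P F (keepInteresting θ P F L) d :=
  by classical exact (mem_filter.1 hd).2.mono keepInteresting_subset

theorem eq_empty_of_forall_not_isMaximal (hL : ∀ d ∈ L, IsInteresting θ P F L d)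
    (hm : ∀ d ∈ L, ¬ IsMaximal θ P F L d) : L = ∅ := by
  by_contra! hne
  have hmem := L.max'_mem hne
  obtain ⟨j, hj, hlt, -, -⟩ := (hL _ hmem).exists_of_not_isMaximal (hm _ hmem)
  exact hlt.not_ge (L.le_max' j hj)

theorem ruleD_le (L : Finset ℕ) (d l : ℕ) (P : ℕ → ℕ) (j : ℕ) : ruleD L d l P j ≤ P j := by
  unfold ruleD
  split_ifs <;> simp

theorem ruleR_le (L : Finset ℕ) (d l : ℕ) (P : ℕ → ℕ) (j : ℕ) : ruleR L d l P j ≤ P j := by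
  unfold ruleR
  split_ifs <;> simp

theorem ruleD_of_notMem (d l : ℕ) (P : ℕ → ℕ) {j : ℕ} (hj : j ∉ L) : ruleD L d l P j = P j := by
  simp [ruleD, hj]

theorem ruleR_of_notMem (d l : ℕ) (P : ℕ → ℕ) {j : ℕ} (hj : j ∉ L) : ruleR L d l P j = P j := by
  simp [ruleR, hj]

end Peaks

section Algorithm

/-- The kind of set that one pass of the scan collects from the PLCP array `P₀`: its values are
positive and strictly increasing, and all its elements are ascents, except perhaps the position `a`
at which the pass began. -/
def IsPeakChain (P₀ : ℕ → ℕ) (A : Finset ℕ) : Prop :=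
  StrictMonoOn P₀ A ∧ (∀ d ∈ A, 0 < P₀ d) ∧
    ∃ a, ∀ d ∈ A, d ≠ a → ∃ c, d = c + 1 ∧ P₀ c < P₀ d

theorem IsPeakChain.subset {P₀ : ℕ → ℕ} {A B : Finset ℕ} (hBA : B ⊆ A) (h : IsPeakChain P₀ A) :
    IsPeakChain P₀ B :=
  ⟨h.1.mono (coe_subset.2 hBA), fun d hd => h.2.1 d (hBA hd),
    h.2.2.imp fun _ ha d hd => ha d (hBA hd)⟩

/-- The invariant of the scan of a text of length `n` whose PLCP array is `P₀`. -/
structure ScanInvariant (P₀ : ℕ → ℕ) (n θ : ℕ) (s : State) : Prop where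
  P_eq : ∀ j, s.start ≤ j → s.P j = P₀ j
  end_le : ∀ f ∈ s.F, f.1 + f.2 ≤ s.start
  start_le : s.start ≤ s.pos
  mem_rest : ∀ d ∈ s.L, d ∈ s.rest n
  lt_pos : ∀ d ∈ s.L, d < s.pos
  isInteresting : ∀ d ∈ s.L, IsInteresting θ s.P s.F (s.rest n) d
  not_isMaximal : ∀ d ∈ s.rest n, d < s.pos → ¬ IsMaximal θ s.P s.F (s.rest n) d

/-- The invariant of the processing of the list, where `P₀` is the PLCP array of the text. -/
structure ProcessInvariant (P₀ : ℕ → ℕ) (θ : ℕ) (s : State) : Prop where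
  P_eq : ∀ j, s.pos ≤ j → s.P j = P₀ j
  end_le : ∀ f ∈ s.F, f.1 + f.2 ≤ s.pos + s.P s.pos
  lt_pos : ∀ d ∈ s.L, d < s.pos
  P_le : ∀ d ∈ s.L, s.P d ≤ s.P s.pos
  isInteresting : ∀ d ∈ s.L, IsInteresting θ s.P s.F s.L d
  isPeakChain : IsPeakChain P₀ s.L

/-- The invariant of the algorithm: the one that belongs to the current phase. -/
def Invariant (P₀ : ℕ → ℕ) (n θ : ℕ) (s : State) : Prop :=
  match s.phase with
  | Phase.scan => ScanInvariant P₀ n θ s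
  | Phase.process => ProcessInvariant P₀ θ s

variable {P₀ : ℕ → ℕ} {n θ : ℕ} {s s' : State}

theorem ScanInvariant.start_le_of_mem (h : ScanInvariant P₀ n θ s) {d : ℕ} (hd : d ∈ s.L) :
    s.start ≤ d :=
  (mem_Ico.1 (h.mem_rest d hd)).1

theorem ScanInvariant.P_eq_of_mem (h : ScanInvariant P₀ n θ s) {d : ℕ} (hd : d ∈ s.L) :
    s.P d = P₀ d :=
  h.P_eq d (h.start_le_of_mem hd)

theorem ScanInvariant.P_lt (h : ScanInvariant P₀ n θ s) {d q : ℕ} (hd : d ∈ s.L) (hdq : d < q)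
    (hqpos : q ≤ s.pos) (hq : IsInteresting θ s.P s.F (s.rest n) q) : s.P d < s.P q :=
  lt_of_forall_not_isMaximal (h.isInteresting d hd) hq (h.mem_rest d hd) hdq
    fun j hj _ hjq => h.not_isMaximal j hj (hjq.trans_le hqpos)

theorem ScanInvariant.P_pos (h : ScanInvariant P₀ n θ s) {d : ℕ} (hd : d ∈ s.L) : 0 < s.P d := by
  obtain ⟨j, -, hdj, hj, -⟩ := (h.isInteresting d hd).exists_of_not_isMaximal
    (h.not_isMaximal d (h.mem_rest d hd) (h.lt_pos d hd))
  omega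

theorem ScanInvariant.exists_ascent (h : ScanInvariant P₀ n θ s) {d : ℕ} (hd : d ∈ s.L)
    (hstart : d ≠ s.start) : ∃ c, d = c + 1 ∧ P₀ c < P₀ d := by
  have hsd := h.start_le_of_mem hd
  rcases (h.isInteresting d hd).1.2 with h0 | hlt | ⟨f, hf, hfd⟩
  · omega
  · rw [h.P_eq_of_mem hd, h.P_eq (d - 1) (by omega)] at hlt
    exact ⟨d - 1, by omega, hlt⟩
  · have := h.end_le f hf
    omega

theorem ScanInvariant.isPeakChain (h : ScanInvariant P₀ n θ s) : IsPeakChain P₀ s.L := by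
  refine ⟨fun d hd e he hde => ?_, fun d hd => h.P_eq_of_mem hd ▸ h.P_pos hd, s.start,
    fun d hd => h.exists_ascent hd⟩
  rw [← h.P_eq_of_mem hd, ← h.P_eq_of_mem he]
  exact h.P_lt hd hde (h.lt_pos e he).le (h.isInteresting e he)

theorem ScanInvariant.skip (h : ScanInvariant P₀ n θ s)
    (hd : ¬ IsInteresting θ s.P s.F (s.rest n) s.pos) :
    ScanInvariant P₀ n θ { s with pos := s.pos + 1 } where
  __ := h
  start_le := h.start_le.trans (Nat.le_succ _)
  lt_pos d hd := (h.lt_pos d hd).trans (Nat.lt_succ_self _)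
  not_isMaximal d hdS hdp := by
    rcases Nat.lt_succ_iff_lt_or_eq.1 hdp with hlt | rfl
    · exact h.not_isMaximal d hdS hlt
    · exact fun hm => hd hm.1

theorem ScanInvariant.insert (h : ScanInvariant P₀ n θ s) (hn : s.pos < n)
    (hd : IsInteresting θ s.P s.F (s.rest n) s.pos)
    (hm : ¬ IsMaximal θ s.P s.F (s.rest n) s.pos) :
    ScanInvariant P₀ n θ { s with pos := s.pos + 1, L := Insert.insert s.pos s.L } where
  __ := h
  start_le := h.start_le.trans (Nat.le_succ _)
  mem_rest := forall_mem_insert _ _ _ |>.2 ⟨mem_Ico.2 ⟨h.start_le, hn⟩, h.mem_rest⟩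
  lt_pos := forall_mem_insert _ _ _ |>.2
    ⟨Nat.lt_succ_self _, fun d hd => (h.lt_pos d hd).trans (Nat.lt_succ_self _)⟩
  isInteresting := forall_mem_insert _ _ _ |>.2 ⟨hd, h.isInteresting⟩
  not_isMaximal d hdS hdp := by
    rcases Nat.lt_succ_iff_lt_or_eq.1 hdp with hlt | rfl
    · exact h.not_isMaximal d hdS hlt
    · exact hm

theorem ScanInvariant.factor (h : ScanInvariant P₀ n θ s)
    (hm : IsMaximal θ s.P s.F (s.rest n) s.pos) {P' : ℕ → ℕ}
    (hP : P' = ruleD s.L s.pos (s.P s.pos) s.P) {F' : Finset (ℕ × ℕ)}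
    (hF : F' = Insert.insert (s.pos, s.P s.pos) s.F) :
    ProcessInvariant P₀ θ { s with
      phase := Phase.process, P := P', F := F', L := keepInteresting θ P' F' s.L } := by
  have hle : ∀ j, P' j ≤ s.P j := hP ▸ ruleD_le _ _ _ _
  have heq : ∀ j, s.pos ≤ j → P' j = s.P j := fun j hj => by
    rw [hP, ruleD_of_notMem _ _ _ fun hjL => (h.lt_pos j hjL).not_ge hj]
  exact {
    P_eq := fun j hj => (heq j hj).trans (h.P_eq j (h.start_le.trans hj))
    end_le := by
      simp only [hF, heq _ le_rfl]
      exact forall_mem_insert _ _ _ |>.2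
        ⟨le_rfl, fun f hf => (h.end_le f hf).trans (h.start_le.trans (Nat.le_add_right _ _))⟩
    lt_pos := fun d hd => h.lt_pos d (keepInteresting_subset hd)
    P_le := fun d hd => by
      have hdL := keepInteresting_subset hd
      simp only [heq _ le_rfl]
      exact (hle d).trans (h.P_lt hdL (h.lt_pos d hdL) le_rfl hm.1).le
    isInteresting := fun d => isInteresting_of_mem_keepInteresting
    isPeakChain := h.isPeakChain.subset keepInteresting_subset }

theorem ProcessInvariant.loop (h : ProcessInvariant P₀ θ s) {j : ℕ} (hj : j ∈ s.L)
    {P' : ℕ → ℕ} (hP : P' = ruleR s.L j (s.P j) (ruleD s.L j (s.P j) s.P))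
    {F' : Finset (ℕ × ℕ)} (hF : F' = Insert.insert (j, s.P j) s.F) :
    ProcessInvariant P₀ θ { s with P := P', F := F', L := keepInteresting θ P' F' s.L } := by
  have hle : ∀ i, P' i ≤ s.P i := fun i => hP ▸ (ruleR_le _ _ _ _ i).trans (ruleD_le _ _ _ _ i)
  have heq : ∀ i, s.pos ≤ i → P' i = s.P i := fun i hi => by
    have hiL : i ∉ s.L := fun hiL => (h.lt_pos i hiL).not_ge hi
    rw [hP, ruleR_of_notMem _ _ _ hiL, ruleD_of_notMem _ _ _ hiL]
  exact {
    P_eq := fun i hi => (heq i hi).trans (h.P_eq i hi)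
    end_le := by
      simp only [hF, heq _ le_rfl]
      exact forall_mem_insert _ _ _ |>.2 ⟨add_le_add (h.lt_pos j hj).le (h.P_le j hj), h.end_le⟩
    lt_pos := fun d hd => h.lt_pos d (keepInteresting_subset hd)
    P_le := fun d hd => by
      simp only [heq _ le_rfl]
      exact (hle d).trans (h.P_le d (keepInteresting_subset hd))
    isInteresting := fun d => isInteresting_of_mem_keepInteresting
    isPeakChain := h.isPeakChain.subset keepInteresting_subset }

theorem ProcessInvariant.resume (h : ProcessInvariant P₀ θ s)
    (hm : ∀ k ∈ s.L, ¬ IsMaximal θ s.P s.F s.L k) :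
    ScanInvariant P₀ n θ { s with
      phase := Phase.scan, pos := s.pos + s.P s.pos, start := s.pos + s.P s.pos } := by
  have hL : s.L = ∅ := eq_empty_of_forall_not_isMaximal h.isInteresting hm
  exact {
    P_eq := fun j hj => h.P_eq j (le_of_add_le_left hj)
    end_le := h.end_le
    start_le := le_rfl
    mem_rest := by simp [hL]
    lt_pos := by simp [hL]
    isInteresting := by simp [hL]
    not_isMaximal := fun d hd hdp => absurd (mem_Ico.1 hd).1 hdp.not_ge }

theorem invariant_iff_of_scan (hs : s.phase = Phase.scan) :
    Invariant P₀ n θ s ↔ ScanInvariant P₀ n θ s := by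
  simp only [Invariant, hs]

theorem invariant_iff_of_process (hs : s.phase = Phase.process) :
    Invariant P₀ n θ s ↔ ProcessInvariant P₀ θ s := by
  simp only [Invariant, hs]

theorem Invariant.isPeakChain (h : Invariant P₀ n θ s) : IsPeakChain P₀ s.L := by
  cases hs : s.phase with
  | scan => exact ((invariant_iff_of_scan hs).1 h).isPeakChain
  | process => exact ((invariant_iff_of_process hs).1 h).isPeakChain

theorem Invariant.step (h : Invariant P₀ n θ s) (hstep : Step n θ s s') :
    Invariant P₀ n θ s' := by
  cases hstep with
  | skip hs hn hd =>
    exact (invariant_iff_of_scan (by exact hs)).2 (((invariant_iff_of_scan hs).1 h).skip hd)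
  | insert hs hn hd hm =>
    exact (invariant_iff_of_scan (by exact hs)).2 (((invariant_iff_of_scan hs).1 h).insert hn hd hm)
  | factor hs hn hm P' hP F' hF =>
    exact (invariant_iff_of_process rfl).2 (((invariant_iff_of_scan hs).1 h).factor hm hP hF)
  | loop hs j hj hm hright P' hP F' hF =>
    exact (invariant_iff_of_process (by exact hs)).2
      (((invariant_iff_of_process hs).1 h).loop hj hP hF)
  | resume hs hm =>
    exact (invariant_iff_of_scan rfl).2 (((invariant_iff_of_process hs).1 h).resume hm)

variable {α : Type u} [LinearOrder α] {T : List α}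

theorem invariant_init (T : List α) (n θ : ℕ) : Invariant (PLCP T) n θ (init T) :=
  (invariant_iff_of_scan rfl).2 {
    P_eq := fun _ _ => rfl
    end_le := by simp [init]
    start_le := le_rfl
    mem_rest := by simp [init]
    lt_pos := by simp [init]
    isInteresting := by simp [init]
    not_isMaximal := by simp [init] }

theorem Reachable.isPeakChain (h : Reachable T θ s) : IsPeakChain (PLCP T) s.L := by
  suffices Invariant (PLCP T) T.length θ s from this.isPeakChain
  induction h with
  | refl => exact invariant_init T _ θ
  | tail _ hstep ih => exact ih.step hstep

end Algorithm

section Bounds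

theorem one_le_mul_logb {n : ℕ} (hn : 2 ≤ n) : (1 : ℝ) ≤ n * Real.logb 2 n := by
  have hn' : (2 : ℝ) ≤ n := by exact_mod_cast hn
  have hlog : (1 : ℝ) ≤ Real.logb 2 n := by
    rw [Real.le_logb_iff_rpow_le one_lt_two (by linarith), Real.rpow_one]
    exact hn'
  exact one_le_mul_of_one_le_of_one_le (by linarith) hlog

variable {α : Type u} [LinearOrder α] {T : List α} {L : Finset ℕ}

theorem IsPeakChain.two_le_length (h : IsPeakChain (PLCP T) L) (hL : L.Nonempty) :
    2 ≤ T.length := by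
  obtain ⟨d, hd⟩ := hL
  exact two_le_length_of_PLCP_pos (h.2.1 d hd)

open Classical in
theorem IsPeakChain.exists_erase_subset (h : IsPeakChain (PLCP T) L) :
    ∃ a, L.erase a ⊆ ({i | IsIrreducible T i} : Finset _).map Fin.valEmbedding := by
  obtain ⟨-, -, a, ha⟩ := h
  refine ⟨a, fun d hd => ?_⟩
  obtain ⟨c, rfl, hlt⟩ := ha d (mem_of_mem_erase hd) (ne_of_mem_erase hd)
  exact mem_map.2 ⟨_, mem_filter.2 ⟨mem_univ _, isIrreducible_of_PLCP_lt hlt⟩, rfl⟩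

theorem IsPeakChain.card_le_bwtRuns_add_two (h : IsPeakChain (PLCP T) L) :
    #L ≤ bwtRuns T + 2 := by
  classical
  obtain ⟨a, ha⟩ := h.exists_erase_subset
  have herase := card_le_card ha
  rw [card_map] at herase
  have := pred_card_le_card_erase (s := L) (a := a)
  have := card_isIrreducible_le T
  omega

theorem IsPeakChain.card_le_three_mul_bwtRuns (h : IsPeakChain (PLCP T) L) :
    #L ≤ 3 * bwtRuns T := by
  rcases L.eq_empty_or_nonempty with rfl | hL
  · simp
  have hruns := bwtRuns_eq (T := T) (by have := h.two_le_length hL; omega)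
  have := h.card_le_bwtRuns_add_two
  omega

theorem IsPeakChain.card_sub_one_sq_le (h : IsPeakChain (PLCP T) L) :
    (#L - 1) ^ 2 ≤ 4 * (T.length * Nat.log 2 T.length) := by
  classical
  obtain ⟨a, ha⟩ := h.exists_erase_subset
  have hinj : Set.InjOn (PLCP T) (L.erase a) :=
    h.1.injOn.mono (coe_subset.2 (erase_subset a L))
  calc (#L - 1) ^ 2
      ≤ #(L.erase a) ^ 2 := Nat.pow_le_pow_left pred_card_le_card_erase 2
    _ ≤ 2 * ∑ d ∈ L.erase a, PLCP T d :=
        card_sq_le_two_mul_sum hinj fun d hd => h.2.1 d (mem_of_mem_erase hd)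
    _ ≤ 2 * ∑ i with IsIrreducible T i, PLCP T i := by
        gcongr
        simpa only [sum_map, Fin.valEmbedding_apply] using sum_le_sum_of_subset ha
    _ ≤ 2 * (2 * (T.length * Nat.log 2 T.length)) := by
        gcongr
        exact sum_PLCP_isIrreducible_le T
    _ = 4 * (T.length * Nat.log 2 T.length) := by ring

theorem IsPeakChain.card_le_three_mul_sqrt (h : IsPeakChain (PLCP T) L) :
    (#L : ℝ) ≤ 3 * √(T.length * Real.logb 2 T.length) := by
  rcases L.eq_empty_or_nonempty with rfl | hL
  · rw [card_empty, Nat.cast_zero]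
    positivity
  have hone := one_le_mul_logb (h.two_le_length hL)
  set x : ℝ := T.length * Real.logb 2 T.length with hx
  have hsq : ((#L : ℝ) - 1) ^ 2 ≤ (2 * √x) ^ 2 :=
    calc ((#L : ℝ) - 1) ^ 2
        = ((#L - 1 : ℕ) : ℝ) ^ 2 := by rw [Nat.cast_pred hL.card_pos]
      _ ≤ 4 * ((T.length : ℝ) * Nat.log 2 T.length) := by exact_mod_cast h.card_sub_one_sq_le
      _ ≤ 4 * x := by
          rw [hx]
          gcongr
          exact_mod_cast Real.natLog_le_logb T.length 2
      _ = (2 * √x) ^ 2 := by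
          rw [mul_pow, Real.sq_sqrt (zero_le_one.trans hone)]
          ring
  have hle := le_of_sq_le_sq hsq (by positivity)
  have hsqrt := Real.one_le_sqrt.2 hone
  linarith

end Bounds

end Plcpcomp

theorem mainTheorem3_general {α : Type u} [LinearOrder α] {T : List α} {θ : ℕ}
    {s : Plcpcomp.State} (hs : Plcpcomp.Reachable T θ s) :
    (s.L.card : ℝ) ≤
      3 * min (Real.sqrt ((T.length : ℝ) * Real.logb 2 (T.length : ℝ)))
        (Plcpcomp.bwtRuns T : ℝ) := by
  rw [mul_min_of_nonneg _ _ zero_le_three, le_min_iff]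
  exact ⟨hs.isPeakChain.card_le_three_mul_sqrt,
    by exact_mod_cast hs.isPeakChain.card_le_three_mul_bwtRuns⟩

theorem mainTheorem3 :
    ∃ C : ℝ, 0 < C ∧
      ∀ (α : Type u) [LinearOrder α] (T : List α) (θ : ℕ),
        Plcpcomp.EndsWithSentinel T → 2 ≤ θ →
        ∀ s : Plcpcomp.State, Plcpcomp.Reachable T θ s →
          (s.L.card : ℝ) ≤
            C * min (Real.sqrt ((T.length : ℝ) * Real.logb 2 (T.length : ℝ)))
              (Plcpcomp.bwtRuns T : ℝ) :=
  ⟨3, by norm_num, fun _ _ _ _ _ _ _ hs => mainTheorem3_general hs⟩
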